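/- Let $H^2(\mathbb D)$ be the Hilbert space of all analytic functions $f(z)=\sum_{n\ge 0}a_nz^n$ on the open unit disc $\mathbb D$ with $(a_n)_{n\ge0}\in\ell^2$, normed by $\|f\|=\|(a_n)\|_{\ell^2}$. Let $\varphi:\mathbb D\to\mathbb D$ and $u:\mathbb D\to\mathbb C$ be analytic and suppose that the weighted composition operator $W=W_{\varphi,u}=M_uC_\varphi$, $(Wf)(z)=u(z)f(\varphi(z))$ for $z\in\mathbb D$, is a bounded linear operator on $H^2(\mathbb D)$. Then the adjoint $W^*$ is an isometry if and only if $W^*$ is unitary. -/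

import Mathlib

open scoped Complex.UnitDisc lp

noncomputable section

/-- A function on the open unit disc `𝔻` is analytic (holomorphic) if it is the restriction of a
function on `ℂ` that is complex differentiable at every point of the disc. -/
def AnalyticOnDisc (f : 𝔻 → ℂ) : Prop :=
  ∃ F : ℂ → ℂ, DifferentiableOn ℂ F (Metric.ball 0 1) ∧ ∀ z : 𝔻, F z = f z

/-- The functions on the open unit disc of the form `f z = ∑ aₙ zⁿ` with `(aₙ) ∈ ℓ²`. -/
def hardySubmodule : Submodule ℂ (𝔻 → ℂ) where
  carrier := {f | ∃ a : ℓ²(ℕ, ℂ), ∀ z : 𝔻, HasSum (fun n ↦ a n * (z : ℂ) ^ n) (f z)}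
  add_mem' := by
    rintro f g ⟨a, ha⟩ ⟨b, hb⟩
    refine ⟨a + b, fun z ↦ ?_⟩
    simpa [add_mul] using (ha z).add (hb z)
  zero_mem' := ⟨0, fun z ↦ by simp⟩
  smul_mem' := by
    rintro c f ⟨a, ha⟩
    refine ⟨c • a, fun z ↦ ?_⟩
    simpa [mul_assoc] using (ha z).mul_left c

/-- The Hardy space `H²(𝔻)`. (A type of its own, so that it carries the `ℓ²` norm of the Taylor
coefficients and not the topology of pointwise convergence.) -/
def HardySpace : Type := hardySubmodule

namespace HardySpace

instance : AddCommGroup HardySpace := inferInstanceAs (AddCommGroup hardySubmodule)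

instance : Module ℂ HardySpace := inferInstanceAs (Module ℂ hardySubmodule)

/-- Elements of the Hardy space are functions on the disc. -/
instance : FunLike HardySpace 𝔻 ℂ where
  coe f := f.1
  coe_injective := Subtype.val_injective

@[ext]
theorem ext {f g : HardySpace} (h : ∀ z, f z = g z) : f = g := DFunLike.ext _ _ h

@[simp] theorem add_apply (f g : HardySpace) (z : 𝔻) : (f + g) z = f z + g z := rfl

@[simp] theorem smul_apply (c : ℂ) (f : HardySpace) (z : 𝔻) : (c • f) z = c * f z := rfl

@[simp] theorem zero_apply (z : 𝔻) : (0 : HardySpace) z = 0 := rfl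

theorem summable_pow (a : ℓ²(ℕ, ℂ)) (z : 𝔻) : Summable (fun n ↦ a n * (z : ℂ) ^ n) := by
  refine .of_norm_bounded
    ((summable_geometric_of_lt_one (norm_nonneg (z : ℂ)) z.norm_lt_one).mul_left ‖a‖) fun n ↦ ?_
  rw [norm_mul, norm_pow]
  gcongr
  exact lp.norm_apply_le_norm (by norm_num) a n

/-- The function `z ↦ ∑ aₙ zⁿ` in the Hardy space. -/
def ofCoeff : ℓ²(ℕ, ℂ) →ₗ[ℂ] HardySpace where
  toFun a := ⟨fun z ↦ ∑' n, a n * (z : ℂ) ^ n, a, fun z ↦ (summable_pow a z).hasSum⟩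
  map_add' a b := by
    ext z
    change ∑' n, (a + b) n * (z : ℂ) ^ n = ∑' n, a n * (z : ℂ) ^ n + ∑' n, b n * (z : ℂ) ^ n
    rw [← (summable_pow a z).tsum_add (summable_pow b z)]
    simp [add_mul]
  map_smul' c a := by
    ext z
    change ∑' n, (c • a) n * (z : ℂ) ^ n = c * ∑' n, a n * (z : ℂ) ^ n
    rw [← tsum_mul_left]
    simp [mul_assoc]

theorem hasSum_ofCoeff (a : ℓ²(ℕ, ℂ)) (z : 𝔻) :
    HasSum (fun n ↦ a n * (z : ℂ) ^ n) (ofCoeff a z) :=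
  (summable_pow a z).hasSum

theorem ofCoeff_injective : Function.Injective ofCoeff := by
  rw [injective_iff_map_eq_zero]
  intro a ha
  have h : HasFPowerSeriesOnBall (0 : ℂ → ℂ)
      (FormalMultilinearSeries.ofScalars ℂ fun n ↦ a n) 0 1 := by
    refine ⟨?_, one_pos, fun {y} hy ↦ ?_⟩
    · refine ENNReal.le_of_forall_nnreal_lt fun r hr ↦ ?_
      refine FormalMultilinearSeries.le_radius_of_bound _ ‖a‖ fun n ↦ ?_
      have hr1 : (r : ℝ) ≤ 1 := by exact_mod_cast hr.le
      calc _ ≤ ‖a‖ * 1 := by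
            gcongr
            · simpa [FormalMultilinearSeries.ofScalars_norm] using
                lp.norm_apply_le_norm (by norm_num) a n
            · exact pow_le_one₀ r.2 hr1
        _ = ‖a‖ := mul_one _
    · have hy1 : ‖y‖ < 1 := by
        have h1 := Metric.mem_eball.1 hy
        rw [edist_zero_right] at h1
        rwa [← ofReal_norm, ENNReal.ofReal_lt_one] at h1
      have h2 := hasSum_ofCoeff a (.mk y hy1)
      rw [ha] at h2
      simpa [FormalMultilinearSeries.ofScalars_apply_eq, mul_comm] using h2
  have h0 := h.hasFPowerSeriesAt.eq_zero
  ext n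
  have h3 := congrArg (fun p ↦ p.coeff n) h0
  have h4 : (0 : FormalMultilinearSeries ℂ ℂ ℂ).coeff n = 0 := rfl
  simpa [FormalMultilinearSeries.coeff_ofScalars, h4] using h3

/-- A function in the Hardy space is determined by its Taylor coefficients `(aₙ) ∈ ℓ²`. -/
def coeffEquiv : HardySpace ≃ₗ[ℂ] ℓ²(ℕ, ℂ) :=
  (LinearEquiv.ofBijective ofCoeff ⟨ofCoeff_injective, fun f ↦ by
    obtain ⟨a, ha⟩ := f.2
    exact ⟨a, ext fun z ↦ (hasSum_ofCoeff a z).unique (ha z)⟩⟩).symm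

theorem hasSum_coeff (f : HardySpace) (z : 𝔻) :
    HasSum (fun n ↦ coeffEquiv f n * (z : ℂ) ^ n) (f z) := by
  have h := hasSum_ofCoeff (coeffEquiv f) z
  rwa [show ofCoeff (coeffEquiv f) = f from coeffEquiv.symm_apply_apply f] at h

/-- The norm of the Hardy space is the `ℓ²` norm of the sequence of Taylor coefficients. -/
instance : NormedAddCommGroup HardySpace :=
  NormedAddCommGroup.induced HardySpace ℓ²(ℕ, ℂ) coeffEquiv coeffEquiv.injective

theorem norm_eq (f : HardySpace) : ‖f‖ = ‖coeffEquiv f‖ := rfl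

instance : InnerProductSpace ℂ HardySpace where
  norm_smul_le c f := by simp [norm_eq, norm_smul]
  inner f g := inner ℂ (coeffEquiv f) (coeffEquiv g)
  norm_sq_eq_re_inner f := by rw [norm_eq]; exact norm_sq_eq_re_inner _
  conj_inner_symm f g := inner_conj_symm _ _
  add_left f g h := by rw [map_add]; exact inner_add_left _ _ _
  smul_left f g c := by rw [map_smul]; exact inner_smul_left _ _ _

/-- The identification of the Hardy space with `ℓ²` as Hilbert spaces. -/
def coeffIsometry : HardySpace ≃ₗᵢ[ℂ] ℓ²(ℕ, ℂ) := ⟨coeffEquiv, fun _ ↦ rfl⟩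

instance : CompleteSpace HardySpace :=
  (completeSpace_congr (e := coeffIsometry.toEquiv) coeffIsometry.isometry.isUniformEmbedding).2
    inferInstance

end HardySpace

/-- `W` is the weighted composition operator `W_{φ,u} = M_u C_φ` on the Hardy space: `φ` is an
analytic self-map of the disc, `u` is analytic on the disc, and `W f = u · (f ∘ φ)`. -/
structure IsWeightedComposition (φ : 𝔻 → 𝔻) (u : 𝔻 → ℂ) (W : HardySpace →L[ℂ] HardySpace) :
    Prop where
  analytic_symbol : AnalyticOnDisc fun z ↦ (φ z : ℂ)
  analytic_weight : AnalyticOnDisc u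
  apply_eq : ∀ (f : HardySpace) (z : 𝔻), W f z = u z * f (φ z)

end

/-!
Write `k w` for the reproducing kernel `z ↦ 1 / (1 - conj w * z)` of the Hardy space. The adjoint
of a weighted composition operator sends `k w` to `conj (u w) • k (φ w)`, so if it is an isometry,
comparing inner products of kernels (`kernel_identity`) gives
`u v * conj (u w) * (1 - conj w * v) = 1 - conj (φ w) * φ v` for all `v w`.
The diagonal `v = w` shows that `u` has no zeros. The case `w = 0` expresses `u` through `φ`, and
substituting it back shows that `φ`, followed by the disc automorphism that exchanges `0` and `φ 0`,
preserves the products `conj w * v`. Hence it is a rotation, and `φ` is surjective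
(`surjective_of_kernel_identity`). A function `f` with `u * (f ∘ φ) = 0` is then zero, that is, `W`
is injective. As `W W* = 1` expresses that `W*` is an isometry, `W` is invertible with inverse `W*`.
-/

open scoped ComplexConjugate InnerProductSpace

namespace HardySpace

theorem memℓp_conj_pow (w : 𝔻) : Memℓp (fun n : ℕ ↦ conj (w : ℂ) ^ n) 2 := by
  refine memℓp_gen ?_
  have hw : ‖(w : ℂ)‖ ^ 2 < 1 := pow_lt_one₀ (norm_nonneg _) w.norm_lt_one two_ne_zero
  refine (summable_geometric_of_lt_one (by positivity) hw).congr fun n ↦ ?_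
  simp [← pow_mul, mul_comm]

/-- The reproducing kernel of the Hardy space at `w`, the function `z ↦ 1 / (1 - conj w * z)`,
given by its Taylor coefficients `conj w ^ n`. -/
noncomputable def kernel (w : 𝔻) : HardySpace :=
  coeffEquiv.symm ⟨fun n ↦ conj (w : ℂ) ^ n, memℓp_conj_pow w⟩

theorem coeffEquiv_kernel (w : 𝔻) (n : ℕ) : coeffEquiv (kernel w) n = conj (w : ℂ) ^ n := by
  simp [kernel]

/-- The reproducing property. -/
theorem inner_kernel_left (w : 𝔻) (f : HardySpace) : ⟪kernel w, f⟫_ℂ = f w := by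
  refine (lp.hasSum_inner (coeffEquiv (kernel w)) (coeffEquiv f)).unique ?_
  simpa [coeffEquiv_kernel] using hasSum_coeff f w

theorem kernel_apply (w z : 𝔻) : kernel w z = (1 - conj (w : ℂ) * z)⁻¹ := by
  refine (hasSum_coeff (kernel w) z).unique ?_
  have h : ‖conj (w : ℂ) * z‖ < 1 := by
    rw [norm_mul, RCLike.norm_conj]
    exact mul_lt_one_of_nonneg_of_lt_one_left (norm_nonneg _) w.norm_lt_one z.norm_lt_one.le
  simpa only [coeffEquiv_kernel, mul_pow] using hasSum_geometric_of_norm_lt_one h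

end HardySpace

theorem one_sub_conj_mul_ne_zero (w z : 𝔻) : 1 - conj (w : ℂ) * z ≠ 0 := by
  intro h
  have h1 : ‖conj (w : ℂ) * z‖ < 1 := by
    rw [norm_mul, RCLike.norm_conj]
    exact mul_lt_one_of_nonneg_of_lt_one_left (norm_nonneg _) w.norm_lt_one z.norm_lt_one.le
  simp [← sub_eq_zero.1 h] at h1

open HardySpace ContinuousLinearMap

theorem IsWeightedComposition.adjoint_kernel {φ : 𝔻 → 𝔻} {u : 𝔻 → ℂ}
    {W : HardySpace →L[ℂ] HardySpace} (hW : IsWeightedComposition φ u W) (w : 𝔻) :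
    adjoint W (kernel w) = conj (u w) • kernel (φ w) := by
  refine ext_inner_right ℂ fun f ↦ ?_
  rw [adjoint_inner_left, inner_smul_left, inner_kernel_left, inner_kernel_left, hW.apply_eq,
    Complex.conj_conj]

/-- If the adjoint of a weighted composition operator is isometric, it preserves the inner products
of reproducing kernels; cleared of denominators, this is a functional equation for the symbols. -/
theorem IsWeightedComposition.kernel_identity {φ : 𝔻 → 𝔻} {u : 𝔻 → ℂ}
    {W : HardySpace →L[ℂ] HardySpace} (hW : IsWeightedComposition φ u W)
    (h : W ∘L adjoint W = 1) (v w : 𝔻) :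
    u v * conj (u w) * (1 - conj (w : ℂ) * v) = 1 - conj (φ w : ℂ) * φ v := by
  have h1 : W (adjoint W (kernel w)) v = kernel w v :=
    congrArg (fun T : HardySpace →L[ℂ] HardySpace ↦ T (kernel w) v) h
  rw [hW.adjoint_kernel, hW.apply_eq, HardySpace.smul_apply, kernel_apply, kernel_apply] at h1
  have h2 := one_sub_conj_mul_ne_zero w v
  have h3 := one_sub_conj_mul_ne_zero (φ w) (φ v)
  field_simp at h1
  linear_combination h1

theorem ne_zero_of_kernel_identity {φ : 𝔻 → 𝔻} {u : 𝔻 → ℂ}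
    (h : ∀ v w : 𝔻, u v * conj (u w) * (1 - conj (w : ℂ) * v) = 1 - conj (φ w : ℂ) * φ v)
    (v : 𝔻) : u v ≠ 0 := fun hv ↦
  one_sub_conj_mul_ne_zero (φ v) (φ v) (by rw [← h v v, hv, zero_mul, zero_mul])

/-- The involutive automorphism of the disc that exchanges `0` and `a`, as a function on `ℂ`. -/
noncomputable def discInvolution (a z : ℂ) : ℂ := (a - z) / (1 - conj a * z)

theorem one_sub_conj_mul_discInvolution (a z w : 𝔻) :
    1 - conj (discInvolution a w) * discInvolution a z =
      (1 - conj (a : ℂ) * a) * (1 - conj (w : ℂ) * z) /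
        ((1 - conj (a : ℂ) * z) * (1 - conj (w : ℂ) * a)) := by
  have h1 := one_sub_conj_mul_ne_zero a z
  have h2 := one_sub_conj_mul_ne_zero w a
  have h3 : 1 - (a : ℂ) * conj (w : ℂ) ≠ 0 := by rwa [mul_comm]
  simp only [discInvolution, map_div₀, map_sub, map_one, map_mul, Complex.conj_conj]
  field_simp
  ring

theorem norm_discInvolution_lt_one (a z : 𝔻) : ‖discInvolution a z‖ < 1 := by
  have h := one_sub_conj_mul_discInvolution a z z
  have hc : 1 - conj (z : ℂ) * a = conj (1 - conj (a : ℂ) * z) := by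
    simp [mul_comm]
  rw [hc, Complex.mul_conj', Complex.conj_mul', Complex.conj_mul', Complex.conj_mul'] at h
  have h' : 1 - ‖discInvolution a z‖ ^ 2 =
      (1 - ‖(a : ℂ)‖ ^ 2) * (1 - ‖(z : ℂ)‖ ^ 2) / ‖1 - conj (a : ℂ) * z‖ ^ 2 := by
    exact_mod_cast h
  have ha := sub_pos.2 a.sq_norm_lt_one
  have hz := sub_pos.2 z.sq_norm_lt_one
  have hd := norm_pos_iff.2 (one_sub_conj_mul_ne_zero a z)
  have hpos : 0 < 1 - ‖discInvolution a z‖ ^ 2 := by rw [h']; positivity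
  exact (sq_lt_one_iff₀ (norm_nonneg _)).1 (sub_pos.1 hpos)

theorem discInvolution_injective (a : 𝔻) : Function.Injective fun z : 𝔻 ↦ discInvolution a z := by
  intro z w hzw
  have h0 := one_sub_conj_mul_ne_zero a a
  have h1 := one_sub_conj_mul_ne_zero a z
  have h2 := one_sub_conj_mul_ne_zero a w
  simp only [discInvolution] at hzw
  rw [div_eq_div_iff h1 h2] at hzw
  refine Complex.UnitDisc.coe_injective (mul_left_cancel₀ h0 ?_)
  linear_combination -hzw

/-- The kernel identity says that `φ`, followed by the disc automorphism exchanging `0` and `φ 0`,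
preserves the products `conj w * v`. Expanding by `one_sub_conj_mul_discInvolution`, every factor is
an instance of the kernel identity. -/
theorem conj_discInvolution_mul_of_kernel_identity {φ : 𝔻 → 𝔻} {u : 𝔻 → ℂ}
    (h : ∀ v w : 𝔻, u v * conj (u w) * (1 - conj (w : ℂ) * v) = 1 - conj (φ w : ℂ) * φ v)
    (v w : 𝔻) :
    conj (discInvolution (φ 0) (φ w)) * discInvolution (φ 0) (φ v) = conj (w : ℂ) * v := by
  have hv := h v 0
  have hw := h 0 w
  have h0 := h 0 0
  simp only [Complex.UnitDisc.coe_zero, map_zero, zero_mul, mul_zero, sub_zero, mul_one]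
    at hv hw h0
  have h1 := ne_zero_of_kernel_identity h
  have h2 (z : 𝔻) : conj (u z) ≠ 0 := by simpa using h1 z
  have h3 := one_sub_conj_mul_discInvolution (φ 0) (φ v) (φ w)
  rw [← h0, ← hv, ← hw, ← h v w] at h3
  have h4 := h1 0
  have h5 := h2 0
  have h6 := h1 v
  have h7 := h2 w
  field_simp at h3
  linear_combination -h3

theorem surjective_of_kernel_identity {φ : 𝔻 → 𝔻} {u : 𝔻 → ℂ}
    (h : ∀ v w : 𝔻, u v * conj (u w) * (1 - conj (w : ℂ) * v) = 1 - conj (φ w : ℂ) * φ v) :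
    Function.Surjective φ := by
  intro y
  have key := conj_discInvolution_mul_of_kernel_identity h
  set ψ : 𝔻 → ℂ := fun v ↦ discInvolution (φ 0) (φ v)
  -- The value of the rotation `ψ` at any nonzero point determines it.
  let p : 𝔻 := .mk (1 / 2) (by norm_num)
  have hp : (p : ℂ) = 1 / 2 := Complex.UnitDisc.coe_mk _ _
  have hq : ‖ψ p‖ = 1 / 2 := by
    have h1 := congrArg norm (key p p)
    rw [norm_mul, norm_mul, RCLike.norm_conj, RCLike.norm_conj, hp] at h1
    have h2 := (mul_self_inj (norm_nonneg _) (norm_nonneg _)).1 h1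
    rw [h2]
    norm_num
  have hq0 : conj (ψ p) ≠ 0 := by
    rw [← norm_ne_zero_iff, RCLike.norm_conj, hq]
    norm_num
  -- The preimage under `ψ` of the image of `y` under the automorphism.
  let v : 𝔻 := .mk (2 * (conj (ψ p) * discInvolution (φ 0) y)) (by
    rw [norm_mul, norm_mul, RCLike.norm_conj, hq, ← mul_assoc]
    simpa using norm_discInvolution_lt_one (φ 0) y)
  have hv : (v : ℂ) = 2 * (conj (ψ p) * discInvolution (φ 0) y) := Complex.UnitDisc.coe_mk _ _
  refine ⟨v, discInvolution_injective (φ 0) (mul_left_cancel₀ hq0 ?_)⟩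
  refine (key v p).trans ?_
  rw [hp, hv, map_div₀, map_one, map_ofNat]
  ring

theorem mainTheorem6 (φ : 𝔻 → 𝔻) (u : 𝔻 → ℂ) (W : HardySpace →L[ℂ] HardySpace)
    (hW : IsWeightedComposition φ u W) :
    Isometry (ContinuousLinearMap.adjoint W) ↔
      ContinuousLinearMap.adjoint W ∈ unitary (HardySpace →L[ℂ] HardySpace) := by
  have hiso : Isometry (adjoint W) ↔ W ∘L adjoint W = 1 := by
    rw [AddMonoidHomClass.isometry_iff_norm, norm_map_iff_adjoint_comp_self, adjoint_adjoint]
  rw [hiso, Unitary.mem_iff, star_eq_adjoint, adjoint_adjoint]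
  refine ⟨fun h ↦ ⟨h, ?_⟩, fun h ↦ h.1⟩
  have hid := hW.kernel_identity h
  have hinj : Function.Injective W := by
    rw [injective_iff_map_eq_zero]
    intro f hf
    ext y
    obtain ⟨z, rfl⟩ := surjective_of_kernel_identity hid y
    have hz := hW.apply_eq f z
    rw [hf, HardySpace.zero_apply] at hz
    exact (mul_eq_zero.1 hz.symm).resolve_left (ne_zero_of_kernel_identity hid z)
  refine ContinuousLinearMap.ext fun f ↦ hinj ?_
  exact congrArg (fun T : HardySpace →L[ℂ] HardySpace ↦ T (W f)) h
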